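/- Let $p>0$ and let $k$ be a field of characteristic $p$. Consider noetherian local rings $R$ with residue field $k$ (that is, equipped with a surjective homomorphism $R\to k$, whose kernel is then the maximal ideal $m_R$) such that $pR\neq 0$. A $k$-scheme $X$ is called liftable to $R$ if there exist a flat $R$-scheme $\tilde X$ and a closed embedding $X\hookrightarrow\tilde X$ inducing an isomorphism of $k$-schemes $X\to\tilde X\times_{\operatorname{Spec} R}\operatorname{Spec} k$. A scheme is Gorenstein if it is locally noetherian and every local ring has finite injective dimension as a module over itself. (1) For every such $R$ there is a zero-dimensional Gorenstein scheme $Z$ of finite type over $k$ that is not liftable to $R$. (2) The scheme can be chosen to depend only on $k$ and on an exponent $e$ with $m_R^e\subset pR$: for every integer $e\ge 0$ there is a zero-dimensional Gorenstein scheme $Z_e$ of finite type over $k$ that is not liftable to any such $R$ with $m_R^e\subset pR$. In particular, if some power of $m_R$ is contained in $pR$, then the scheme in (1) may be taken to depend only on $k$ and on the smallest $e$ with $m_R^e\subset pR$. -/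

import Mathlib

open CategoryTheory AlgebraicGeometry

universe u

/-- A Gorenstein local ring: a noetherian local ring of finite injective dimension as a module
over itself. -/
def IsGorensteinLocalRing (A : Type u) [CommRing A] : Prop :=
  IsLocalRing A ∧ IsNoetherianRing A ∧ ∃ n : ℕ, HasInjectiveDimensionLE (ModuleCat.of A A) n

/-- A Gorenstein scheme: a locally noetherian scheme all of whose local rings are Gorenstein. -/
def IsGorensteinScheme (X : Scheme.{u}) : Prop :=
  IsLocallyNoetherian X ∧ ∀ x : X, IsGorensteinLocalRing (X.presheaf.stalk x)

/-- A `k`-scheme `f : X ⟶ Spec k` is liftable to `φ : R → k` if there are a flat `R`-scheme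
`π : Y ⟶ Spec R` and a closed embedding `i : X ⟶ Y` that induces an isomorphism of `k`-schemes
from `X` to the base change of `Y` along `φ`. -/
def IsLiftable {R k : Type u} [CommRing R] [Field k] (φ : R →+* k)
    {X : Scheme.{u}} (f : X ⟶ Spec (CommRingCat.of k)) : Prop :=
  ∃ (Y : Scheme.{u}) (π : Y ⟶ Spec (CommRingCat.of R)) (i : X ⟶ Y),
    Flat π ∧ IsClosedImmersion i ∧ IsPullback i f π (Spec.map (CommRingCat.ofHom φ))

/-- A zero-dimensional Gorenstein `k`-scheme (of finite type, hence finite over `k`). -/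
structure IsZeroDimGorenstein {k : Type u} [Field k]
    {X : Scheme.{u}} (f : X ⟶ Spec (CommRingCat.of k)) : Prop where
  isFinite : IsFinite f
  dim_eq_zero : topologicalKrullDim X = 0
  gorenstein : IsGorensteinScheme X

/-!
Let `q = p ^ n`. The nonliftable scheme is the spectrum of a quotient `A` of the polynomial ring over
`k` in the variables `x j i`, with three rows `j` of `n + 1` variables each. Write `X j` for the
product of the `j`-th row and `C a b` for the integral polynomial `((a + b) ^ p - a ^ p - b ^ p) / p`
(`frobeniusCarry`). The algebra is arranged so that in `A`

* `x j i ^ (p * q) = 0`,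
* `X 0 + X 1 + X 2 = 0`,
* `C (X 0 ^ q) (X 1 ^ q) ≠ 0`.

Why `A` does not lift: consider the quotient of `R` by an ideal `I` not containing `p`, but
containing `p * 𝔪` and `𝔪 ^ (n + 1)`. Let `S` be the corresponding quotient of a flat lifting of
`A`, and let `M` be the ideal `𝔪 S`, so `p * M = 0` and `M ^ (n + 1) = 0`. Lift
the variables to `S`. The `p * q`-th power of a lifted row product is a product of `n + 1` elements
of `M`, hence zero. The `q`-th power of the sum of the lifted row products is zero too, since
`n + 1 ≤ q`; so the `q`-th powers of the lifted row products have sum in `p S`. As `p ^ 2 = 0` in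
`S`, taking `p`-th powers gives `(X 0 ^ q + X 1 ^ q) ^ p = 0`, and expanding this leaves
`p * C (X 0 ^ q) (X 1 ^ q) = 0` in `S` (`natCast_mul_frobeniusCarry_eq_zero`). By flatness an
element killed by `p` lies in `M` (`mem_map_of_mul_mem_map_of_flat`), so `C (X 0 ^ q) (X 1 ^ q)`
vanishes in `A`, a contradiction (`not_isLiftable_rowIdeal`).

Why `A` is Gorenstein: it is the quotient of the polynomial ring by the largest ideal in the kernel
of a linear functional, and such a quotient, when finite over `k`, is isomorphic to its own
`k`-dual, hence self-injective (`injective_self_of_nondegenerate`). The functional reads a monomial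
in the row products as a polynomial in `X`, `Y`, `Z`, substitutes `Z = -X - Y`, and takes the
coefficient of `X ^ q * Y ^ (p * q - q)`; it kills all other monomials. It kills the multiples of
the `p * q`-th powers of the variables because `(X + Y) ^ (p * q) = X ^ (p * q) + Y ^ (p * q)` in
characteristic `p`, and it takes the value `1` at the carry.

A lifting need not be affine, but the spectrum of a local algebra is contained in any open
neighbourhood of its closed point, which reduces liftings to flat algebras
(`IsLiftable.exists_flat_algebra`). If `𝔪 ^ e` lies in `p R`, the ideal `I = p * 𝔪` serves with
`n = e`, by Nakayama's lemma; in general `I = p * 𝔪 + 𝔪 ^ (n + 1)` serves for some `n`, by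
Krull's intersection theorem.
-/

/-! ### The carry of the Frobenius -/

/-- For `p` prime, the carry `((a + b) ^ p - a ^ p - b ^ p) / p` of the `p`-th power map, as an
integral polynomial expression in `a` and `b`. The division in ℕ is exact. -/
def frobeniusCarry {S : Type*} [CommRing S] (p : ℕ) (a b : S) : S :=
  ∑ k ∈ Finset.Ioo 0 p, a ^ k * b ^ (p - k) * ((p.choose k / p : ℕ) : S)

lemma map_frobeniusCarry {S T : Type*} [CommRing S] [CommRing T] (f : S →+* T) (p : ℕ) (a b : S) :
    f (frobeniusCarry p a b) = frobeniusCarry p (f a) (f b) := by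
  simp [frobeniusCarry]

lemma add_pow_prime_eq_frobeniusCarry {S : Type*} [CommRing S] {p : ℕ} (hp : p.Prime) (a b : S) :
    (a + b) ^ p = a ^ p + b ^ p + p * frobeniusCarry p a b :=
  add_pow_prime_eq' hp a b

/-- The obstruction. If `p` kills `M` and `M ^ (n + 1) = 0`, then three products of `n + 1` elements
whose `p ^ (n + 1)`-st powers lie in `M` cannot have sum in `M` unless `p` kills the carry of
the `p ^ n`-th powers of two of the products. -/
lemma natCast_mul_frobeniusCarry_eq_zero {S : Type*} [CommRing S] {p n : ℕ} (hp : p.Prime)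
    {M : Ideal S} (hM : M ^ (n + 1) = ⊥) (hpM : (p : S) ∈ M) (hann : ∀ a ∈ M, (p : S) * a = 0)
    (x : Fin 3 → Fin (n + 1) → S) (hx : ∀ j i, x j i ^ (p * p ^ n) ∈ M)
    (hsum : ∑ j, ∏ i, x j i ∈ M) :
    (p : S) * frobeniusCarry p ((∏ i, x 0 i) ^ p ^ n) ((∏ i, x 1 i) ^ p ^ n) = 0 := by
  have hpp : (p : S) * p = 0 := hann _ hpM
  -- A product of `n + 1` elements of `M` vanishes.
  have hpow (j : Fin 3) : ((∏ i, x j i) ^ p ^ n) ^ p = 0 := by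
    rw [← pow_mul, mul_comm, ← Finset.prod_pow]
    have h : ∏ i, x j i ^ (p * p ^ n) ∈ ∏ _i : Fin (n + 1), M :=
      Ideal.prod_mem_prod fun i _ ↦ hx j i
    rw [Finset.prod_const, Finset.card_fin, hM] at h
    simpa using h
  -- `n + 1 ≤ p ^ n`, so the `p ^ n`-th power of the sum vanishes.
  have hs : (∑ j, ∏ i, x j i) ^ p ^ n = 0 := by
    have h := Ideal.pow_mem_pow hsum (p ^ n)
    have h' := Ideal.pow_le_pow_right (Nat.succ_le_of_lt (Nat.lt_pow_self hp.one_lt (n := n))) h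
    rw [hM] at h'
    simpa using h'
  rw [Fin.sum_univ_three] at hs
  obtain ⟨r, hr⟩ := exists_add_pow_prime_pow_eq hp ((∏ i, x 0 i) + ∏ i, x 1 i) (∏ i, x 2 i) n
  obtain ⟨t, ht⟩ := exists_add_pow_prime_pow_eq hp (∏ i, x 0 i) (∏ i, x 1 i) n
  rw [hs, ht] at hr
  have h0 := hpow 0
  have h1 := hpow 1
  have h2 := hpow 2
  generalize (∏ i, x 0 i) ^ p ^ n = a at *
  generalize (∏ i, x 1 i) ^ p ^ n = b at *
  generalize (∏ i, x 2 i) ^ p ^ n = c at *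
  obtain ⟨h, hh⟩ : ∃ h, a + b = -c + p * h := by
    refine ⟨-((∏ i, x 0 i) * (∏ i, x 1 i) * t +
      ((∏ i, x 0 i) + ∏ i, x 1 i) * (∏ i, x 2 i) * r), ?_⟩
    linear_combination -hr
  have hab : (a + b) ^ p = 0 := by
    obtain ⟨u, hu⟩ := exists_add_pow_prime_eq hp (-c) (p * h)
    obtain ⟨m, rfl⟩ : ∃ m, p = m + 2 := ⟨p - 2, by have := hp.two_le; omega⟩
    rw [hh, hu, neg_pow, h2, pow_add]
    linear_combination (((m + 2 : ℕ) : S) ^ m * h ^ (m + 2) - c * h * u) * hpp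
  rw [add_pow_prime_eq_frobeniusCarry hp, h0, h1] at hab
  simpa using hab

/-- Over a flat algebra, division by `r` modulo an extended ideal `I` is controlled by the colon
ideal `I : r`. -/
lemma mem_map_of_mul_mem_map_of_flat {R B : Type*} [CommRing R] [CommRing B] [Algebra R B]
    [Module.Flat R B] {I J : Ideal R} {r : R} (hJ : ∀ a, r * a ∈ I → a ∈ J) {b : B}
    (hb : algebraMap R B r * b ∈ I.map (algebraMap R B)) : b ∈ J.map (algebraMap R B) := by
  obtain ⟨c, s, t, hs⟩ : ∃ (c : ℕ) (s : Fin c → I) (t : Fin c → B),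
      algebraMap R B r * b = ∑ i, (s i : R) • t i := by
    obtain ⟨c, t, g, h⟩ := Submodule.mem_span_set'.mp hb
    choose s hs hs' using fun i ↦ (g i).2
    refine ⟨c, fun i ↦ ⟨s i, hs i⟩, t, h.symm.trans (Finset.sum_congr rfl fun i _ ↦ ?_)⟩
    rw [smul_eq_mul, Algebra.smul_def (s i), hs', mul_comm]
  let f : Option (Fin c) → R := fun i ↦ i.elim r fun i ↦ -(s i : R)
  let x : Option (Fin c) → B := fun i ↦ i.elim b t
  have hrel : ∑ i, f i • x i = 0 := by
    simp [f, x, Fintype.sum_option, Algebra.smul_def, hs]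
  -- The columns of a matrix trivializing this relation have their entry at `none` in `I : r`.
  obtain ⟨m, a, y, h1, h2⟩ :=
    Module.Flat.isTrivialRelation_of_sum_smul_eq_zero (f := f) (x := x) hrel
  have hb' : b = ∑ j, a none j • y j := h1 none
  rw [hb']
  refine Ideal.sum_mem _ fun j _ ↦ ?_
  rw [Algebra.smul_def]
  refine Ideal.mul_mem_right _ _ (Ideal.mem_map_of_mem _ (hJ _ ?_))
  have := h2 j
  simp only [f, Fintype.sum_option, Option.elim] at this
  rw [eq_neg_of_add_eq_zero_left this]
  refine I.neg_mem (I.sum_mem fun i _ ↦ ?_)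
  exact I.mul_mem_right _ (I.neg_mem (s i).2)

/-! ### Algebras with a nondegenerate functional -/

/-- A finite algebra over a field with a functional `l` for which `(a, b) ↦ l (a * b)` is nondegenerate
is injective over itself: the pairing identifies it with its own `k`-linear dual. -/
lemma injective_self_of_nondegenerate {k A : Type u} [Field k] [CommRing A] [Algebra k A]
    [Module.Finite k A] (l : A →ₗ[k] k) (hl : ∀ a, (∀ b, l (a * b) = 0) → a = 0) :
    Module.Injective A A := by
  refine Module.Baer.injective fun I g ↦ ?_
  obtain ⟨h, hh⟩ := LinearMap.exists_extend (p := I.restrictScalars k)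
    (l ∘ₗ (g.restrictScalars k : I.restrictScalars k →ₗ[k] A))
  -- `a ↦ l (a * ·)` is an injection between spaces of equal dimension.
  let d : A →ₗ[k] Module.Dual k A := (LinearMap.mul k A).compr₂ l
  have hd : Function.Injective d := (injective_iff_map_eq_zero d).mpr fun a ha ↦
    hl a fun b ↦ LinearMap.congr_fun ha b
  obtain ⟨a, ha⟩ := (LinearMap.injective_iff_surjective_of_finrank_eq_finrank
    (Subspace.dual_finrank_eq).symm).mp hd h
  refine ⟨LinearMap.mulLeft A a, fun i hi ↦ ?_⟩
  rw [eq_comm, ← sub_eq_zero]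
  refine hl _ fun b ↦ ?_
  have h1 : l (g ⟨i * b, I.mul_mem_right b hi⟩) = l (a * (i * b)) := by
    have h2 := LinearMap.congr_fun hh ⟨i * b, I.mul_mem_right b hi⟩
    rw [← ha] at h2
    exact h2.symm
  have h3 : g ⟨i * b, I.mul_mem_right b hi⟩ = g ⟨i, hi⟩ * b := by
    rw [mul_comm (g _)]
    exact (congrArg g (Subtype.ext (mul_comm i b))).trans (map_smul g b ⟨i, hi⟩)
  rw [h3] at h1
  simp [sub_mul, h1, mul_assoc]

lemma IsGorensteinLocalRing.of_ringEquiv {A B : Type u} [CommRing A] [CommRing B] [IsLocalRing A]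
    [IsNoetherianRing A] [Module.Injective A A] (e : A ≃+* B) : IsGorensteinLocalRing B := by
  have : Module.Injective B B := Module.Injective.of_ringEquiv e e.toSemilinearEquiv
  have : Injective (ModuleCat.of B B) := Module.injective_object_of_injective_module B B
  exact ⟨e.isLocalRing, isNoetherianRing_of_ringEquiv A e, 0,
    injective_iff_hasInjectiveDimensionLT_one.mp this⟩

/-- The spectrum of a finite local `k`-algebra that is injective over itself. -/
lemma isZeroDimGorenstein_spec {k A : Type u} [Field k] [CommRing A] [Algebra k A]
    [Module.Finite k A] [IsLocalRing A] [Module.Injective A A] :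
    IsZeroDimGorenstein (Spec.map (CommRingCat.ofHom (algebraMap k A))) := by
  have : IsArtinianRing A := IsArtinianRing.of_finite k A
  refine ⟨?_, ?_, ?_, fun x ↦ ?_⟩
  · rw [IsFinite.SpecMap_iff]
    exact RingHom.finite_algebraMap.mpr inferInstance
  · exact (PrimeSpectrum.topologicalKrullDim_eq_ringKrullDim A).trans
      (ringKrullDimZero_iff_ringKrullDim_eq_zero.mp inferInstance)
  · exact isLocallyNoetherian_Spec.mpr (inferInstanceAs (IsNoetherianRing A))
  · let y : PrimeSpectrum A := x
    have hx : y.asIdeal = IsLocalRing.maximalIdeal A :=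
      IsLocalRing.eq_maximalIdeal inferInstance
    let e : A ≃ₐ[A] Localization.AtPrime y.asIdeal :=
      IsLocalization.atUnits A y.asIdeal.primeCompl fun a ha ↦ by
        simpa [Ideal.primeCompl, hx, IsUnit.mem_submonoid_iff] using ha
    exact IsGorensteinLocalRing.of_ringEquiv (e.toRingEquiv.trans
      (Spec.stalkIso (CommRingCat.of A) x).symm.commRingCatIsoToRingEquiv)

/-- The largest ideal contained in the kernel of a linear functional. -/
def functionalIdeal {k P : Type*} [Field k] [CommRing P] [Algebra k P] (l : P →ₗ[k] k) :
    Ideal P where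
  carrier := {b | ∀ c, l (b * c) = 0}
  add_mem' ha hb c := by rw [add_mul, map_add, ha, hb, add_zero]
  zero_mem' c := by simp
  smul_mem' a b hb c := by
    rw [smul_eq_mul, mul_comm a b, mul_assoc]
    exact hb _

lemma mem_functionalIdeal {k P : Type*} [Field k] [CommRing P] [Algebra k P] {l : P →ₗ[k] k}
    {b : P} : b ∈ functionalIdeal l ↔ ∀ c, l (b * c) = 0 :=
  Iff.rfl

lemma injective_quotient_functionalIdeal {k P : Type u} [Field k] [CommRing P] [Algebra k P]
    (l : P →ₗ[k] k) [Module.Finite k (P ⧸ functionalIdeal l)] :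
    Module.Injective (P ⧸ functionalIdeal l) (P ⧸ functionalIdeal l) := by
  have hle : (functionalIdeal l).restrictScalars k ≤ LinearMap.ker l := fun b hb ↦ by
    simpa using mem_functionalIdeal.mp hb 1
  refine injective_self_of_nondegenerate (((functionalIdeal l).restrictScalars k).liftQ l hle ∘ₗ
    (Submodule.Quotient.restrictScalarsEquiv k (functionalIdeal l)).symm.toLinearMap) fun a ha ↦ ?_
  obtain ⟨a, rfl⟩ := Ideal.Quotient.mk_surjective a
  exact Ideal.Quotient.eq_zero_iff_mem.mpr fun c ↦ ha (Ideal.Quotient.mk _ c)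

section Nilpotent

variable {k σ : Type*} [Field k] {I : Ideal (MvPolynomial σ k)}

/-- If the variables are nilpotent modulo `I`, then every residue class is the sum of a constant and
a nilpotent element. -/
lemma isLocalRing_quotient_of_isNilpotent (hI : I ≠ ⊤)
    (h : ∀ i, IsNilpotent (Ideal.Quotient.mk I (MvPolynomial.X i))) :
    IsLocalRing (MvPolynomial σ k ⧸ I) := by
  have : Nontrivial (MvPolynomial σ k ⧸ I) := Ideal.Quotient.nontrivial_iff.mpr hI
  have key (f : MvPolynomial σ k) : ∃ c : k,
      Ideal.Quotient.mk I f - algebraMap k _ c ∈ nilradical (MvPolynomial σ k ⧸ I) := by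
    induction f using MvPolynomial.induction_on with
    | C a => exact ⟨a, by
        rw [← MvPolynomial.algebraMap_eq, Ideal.Quotient.mk_algebraMap, sub_self]
        exact zero_mem _⟩
    | add f g hf hg =>
      obtain ⟨c, hc⟩ := hf
      obtain ⟨d, hd⟩ := hg
      refine ⟨c + d, ?_⟩
      rw [map_add, map_add, add_sub_add_comm]
      exact add_mem hc hd
    | mul_X f i _ =>
      refine ⟨0, ?_⟩
      rw [map_mul, map_zero, sub_zero]
      exact Ideal.mul_mem_left _ _ (h i)
  refine IsLocalRing.of_isUnit_or_isUnit_one_sub_self fun a ↦ ?_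
  obtain ⟨f, rfl⟩ := Ideal.Quotient.mk_surjective a
  obtain ⟨c, hc⟩ := key f
  rw [mem_nilradical] at hc
  by_cases h0 : c = 0
  · right
    subst h0
    rw [map_zero, sub_zero] at hc
    exact hc.isUnit_one_sub
  · left
    have h1 : IsUnit (algebraMap k (MvPolynomial σ k ⧸ I) c) := (IsUnit.mk0 c h0).map _
    simpa using hc.isUnit_add_left_of_commute h1 (Commute.all _ _)

lemma finite_quotient_of_isNilpotent [Finite σ]
    (h : ∀ i, IsNilpotent (Ideal.Quotient.mk I (MvPolynomial.X i))) :
    Module.Finite k (MvPolynomial σ k ⧸ I) := by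
  have hint : Algebra.IsIntegral k (MvPolynomial σ k ⧸ I) := by
    refine ⟨fun a ↦ ?_⟩
    obtain ⟨f, rfl⟩ := Ideal.Quotient.mk_surjective a
    induction f using MvPolynomial.induction_on with
    | C a => exact isIntegral_algebraMap (R := k) (x := a)
    | add f g hf hg => rw [map_add]; exact hf.add hg
    | mul_X f i hf =>
      rw [map_mul]
      obtain ⟨m, hm⟩ := h i
      refine hf.mul (IsIntegral.of_pow (n := m + 1) m.succ_pos ?_)
      rw [pow_succ, hm, zero_mul]
      exact isIntegral_zero
  exact Algebra.IsIntegral.finite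

end Nilpotent

/-! ### The functional -/

/-- The coefficient of `X ^ q * Y ^ (N - q)` in `X ^ a * Y ^ b * (-X - Y) ^ c`, where `q ≤ N`. -/
def trinomialWeight (k : Type*) [CommRing k] (N q a b c : ℕ) : k :=
  if a + b + c = N ∧ a ≤ q then (-1) ^ c * (c.choose (q - a) : k) else 0

section trinomialWeight

variable {k : Type*} [CommRing k]

lemma trinomialWeight_add {N q : ℕ} (a b c : ℕ) :
    trinomialWeight k N q (a + 1) b c + trinomialWeight k N q a (b + 1) c +
      trinomialWeight k N q a b (c + 1) = 0 := by
  have h1 : (a + 1 + b + c = N) ↔ a + b + c + 1 = N := by omega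
  have h2 : (a + (b + 1) + c = N) ↔ a + b + c + 1 = N := by omega
  have h3 : (a + b + (c + 1) = N) ↔ a + b + c + 1 = N := by omega
  simp only [trinomialWeight, h1, h2, h3]
  by_cases hN : a + b + c + 1 = N
  · rcases lt_trichotomy a q with h | rfl | h
    · obtain ⟨m, rfl⟩ : ∃ m, q = a + 1 + m := ⟨q - (a + 1), by omega⟩
      have e1 : a + 1 + m - a = m + 1 := by omega
      rw [if_pos ⟨hN, by omega⟩, if_pos ⟨hN, by omega⟩, if_pos ⟨hN, by omega⟩, e1,
        Nat.add_sub_cancel_left, Nat.choose_succ_succ]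
      push_cast
      ring
    · rw [if_neg (by omega), if_pos ⟨hN, le_rfl⟩, if_pos ⟨hN, le_rfl⟩]
      simp [pow_succ]
    · rw [if_neg (by omega), if_neg (by omega), if_neg (by omega)]
      simp
  · simp [hN]

/-- The weight vanishes on multiples of the `p ^ (n + 1)`-st power of any of the three monomials. -/
lemma trinomialWeight_eq_zero {p n : ℕ} [CharP k p] (hp : p.Prime) {a b c : ℕ}
    (h : p * p ^ n ≤ a ∨ p * p ^ n ≤ b ∨ p * p ^ n ≤ c) :
    trinomialWeight k (p * p ^ n) (p ^ n) a b c = 0 := by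
  have hlt : p ^ n < p * p ^ n :=
    lt_mul_of_one_lt_left (pow_pos hp.pos n) hp.one_lt
  rw [trinomialWeight]
  split_ifs with hc
  · obtain ⟨hN, ha⟩ := hc
    rcases h with h | h | h
    · omega
    · obtain ⟨rfl, rfl⟩ : a = 0 ∧ c = 0 := by omega
      rw [Nat.choose_eq_zero_of_lt (by simpa using pow_pos hp.pos n)]
      simp
    · obtain ⟨rfl, rfl⟩ : a = 0 ∧ b = 0 := by omega
      obtain rfl : c = p ^ (n + 1) := by rw [pow_succ]; linarith
      have hd : p ∣ (p ^ (n + 1)).choose (p ^ n - 0) :=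
        hp.dvd_choose_pow (pow_pos hp.pos n).ne' (Nat.pow_lt_pow_right hp.one_lt n.lt_succ_self).ne
      rw [(CharP.cast_eq_zero_iff k p _).mpr hd, mul_zero]
  · rfl

end trinomialWeight

section rowFunctional

open MvPolynomial

/-- The exponent of the product of the variables in row `j`. -/
noncomputable def rowExponent (n : ℕ) (j : Fin 3) : Fin 3 × Fin (n + 1) →₀ ℕ :=
  ∑ i, Finsupp.single (j, i) 1

lemma rowExponent_apply (n : ℕ) (j j' : Fin 3) (i : Fin (n + 1)) :
    rowExponent n j (j', i) = if j = j' then 1 else 0 := by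
  simp only [rowExponent, Finsupp.finsetSum_apply, Finsupp.single_apply, Prod.mk.injEq]
  by_cases h : j = j' <;> simp [h]

lemma prod_X_eq_monomial_rowExponent {k : Type*} [CommRing k] (n : ℕ) (j : Fin 3) :
    ∏ i, (X (j, i) : MvPolynomial (Fin 3 × Fin (n + 1)) k) = monomial (rowExponent n j) 1 := by
  simp [rowExponent, X, ← monomial_sum_one]

/-- The functional on monomials: it is supported on the monomials in the three row products, where
it is `trinomialWeight`. -/
noncomputable def rowWeight (k : Type*) [CommRing k] (p n : ℕ) (d : Fin 3 × Fin (n + 1) →₀ ℕ) : k :=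
  open Classical in
  if ∀ j i, d (j, i) = d (j, 0) then
    trinomialWeight k (p * p ^ n) (p ^ n) (d (0, 0)) (d (1, 0)) (d (2, 0)) else 0

/-- The linear functional with values `rowWeight` on monomials. -/
noncomputable def rowFunctional (k : Type*) [CommRing k] (p n : ℕ) :
    MvPolynomial (Fin 3 × Fin (n + 1)) k →ₗ[k] k :=
  (basisMonomials _ k).constr k (rowWeight k p n)

lemma rowFunctional_monomial {k : Type*} [CommRing k] (p n : ℕ) (d : Fin 3 × Fin (n + 1) →₀ ℕ)
    (a : k) : rowFunctional k p n (monomial d a) = a * rowWeight k p n d := by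
  have h : rowFunctional k p n (monomial d 1) = rowWeight k p n d := by
    simpa [rowFunctional] using (basisMonomials _ k).constr_basis k (rowWeight k p n) d
  rw [← h, ← smul_eq_mul, ← map_smul, smul_monomial, smul_eq_mul, mul_one]

lemma rowWeight_add_single {k : Type*} [CommRing k] {p n : ℕ} [CharP k p] (hp : p.Prime)
    (j : Fin 3) (i : Fin (n + 1)) (d : Fin 3 × Fin (n + 1) →₀ ℕ) :
    rowWeight k p n (Finsupp.single (j, i) (p * p ^ n) + d) = 0 := by
  rw [rowWeight]
  split_ifs with h
  · refine trinomialWeight_eq_zero hp ?_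
    have h1 : p * p ^ n ≤ (Finsupp.single (j, i) (p * p ^ n) + d) (j, 0) := by
      rw [← h j i]
      simp
    fin_cases j
    exacts [.inl h1, .inr (.inl h1), .inr (.inr h1)]
  · rfl

lemma sum_rowWeight_rowExponent_add {k : Type*} [CommRing k] (p n : ℕ)
    (d : Fin 3 × Fin (n + 1) →₀ ℕ) : ∑ j, rowWeight k p n (rowExponent n j + d) = 0 := by
  by_cases h : ∀ j i, d (j, i) = d (j, 0)
  · have h' (j) : rowWeight k p n (rowExponent n j + d) = trinomialWeight k (p * p ^ n) (p ^ n)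
        (d (0, 0) + if j = 0 then 1 else 0) (d (1, 0) + if j = 1 then 1 else 0)
        (d (2, 0) + if j = 2 then 1 else 0) := by
      rw [rowWeight, if_pos]
      · simp only [Finsupp.add_apply, rowExponent_apply, add_comm]
      · simp [rowExponent_apply, h]
    simp only [Fin.sum_univ_three, h']
    simpa using! trinomialWeight_add (k := k) (d (0, 0)) (d (1, 0)) (d (2, 0))
  · refine Finset.sum_eq_zero fun j _ ↦ ?_
    rw [rowWeight, if_neg]
    simpa [rowExponent_apply] using h

/-! ### The Gorenstein algebra -/

/-- The ideal of the Gorenstein quotient of the polynomial ring dual to `rowFunctional`. -/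
noncomputable abbrev rowIdeal (k : Type*) [Field k] (p n : ℕ) :
    Ideal (MvPolynomial (Fin 3 × Fin (n + 1)) k) :=
  functionalIdeal (rowFunctional k p n)

section rowIdeal

variable {k : Type*} [Field k] {p : ℕ} (n : ℕ)

lemma mem_rowIdeal_of_monomial {f : MvPolynomial (Fin 3 × Fin (n + 1)) k}
    (h : ∀ d, rowFunctional k p n (f * monomial d 1) = 0) : f ∈ rowIdeal k p n := by
  intro c
  induction c using MvPolynomial.induction_on' with
  | monomial d a =>
    have h1 : monomial d a = a • (monomial d 1 : MvPolynomial (Fin 3 × Fin (n + 1)) k) := by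
      rw [smul_monomial, smul_eq_mul, mul_one]
    rw [h1, mul_smul_comm, map_smul, h, smul_zero]
  | add f g hf hg => rw [mul_add, map_add, hf, hg, add_zero]

lemma X_pow_mem_rowIdeal [CharP k p] (hp : p.Prime) (j : Fin 3) (i : Fin (n + 1)) :
    X (j, i) ^ (p * p ^ n) ∈ rowIdeal k p n := by
  refine mem_rowIdeal_of_monomial n fun d ↦ ?_
  rw [X_pow_eq_monomial, monomial_mul, rowFunctional_monomial, rowWeight_add_single hp, mul_zero]

lemma sum_prod_X_mem_rowIdeal : ∑ j, ∏ i, X (j, i) ∈ rowIdeal k p n := by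
  refine mem_rowIdeal_of_monomial n fun d ↦ ?_
  simp only [prod_X_eq_monomial_rowExponent, Finset.sum_mul, monomial_mul, map_sum,
    rowFunctional_monomial, one_mul, sum_rowWeight_rowExponent_add]

/-- The functional takes the value `1` on the carry: only its term of degree one in the first
argument contributes, and that term has coefficient `p.choose 1 / p = 1`. -/
lemma frobeniusCarry_notMem_rowIdeal (hp : p.Prime) :
    frobeniusCarry p ((∏ i, X (0, i)) ^ p ^ n) ((∏ i, X (1, i)) ^ p ^ n) ∉ rowIdeal k p n := by
  intro h
  have h1 := mem_functionalIdeal.mp h 1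
  have hq : 0 < p ^ n := pow_pos hp.pos n
  have hterm (m c : ℕ) : rowFunctional k p n
      (((∏ i, X (0, i)) ^ p ^ n) ^ m * ((∏ i, X (1, i)) ^ p ^ n) ^ (p - m) *
        (c : MvPolynomial _ k)) =
        c * trinomialWeight k (p * p ^ n) (p ^ n) (m * p ^ n) ((p - m) * p ^ n) 0 := by
    rw [prod_X_eq_monomial_rowExponent, prod_X_eq_monomial_rowExponent, monomial_pow, monomial_pow,
      monomial_pow, monomial_pow, monomial_mul, ← map_natCast (C : k →+* MvPolynomial _ k) c,
      mul_comm, C_mul_monomial, rowFunctional_monomial, rowWeight, if_pos]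
    · simp [rowExponent_apply]
    · simp [rowExponent_apply]
  rw [mul_one, frobeniusCarry, map_sum, Finset.sum_eq_single_of_mem 1
    (Finset.mem_Ioo.mpr ⟨one_pos, hp.one_lt⟩), hterm, Nat.choose_one_right, Nat.div_self hp.pos,
    trinomialWeight, if_pos] at h1
  · simp at h1
  · refine ⟨?_, by simp⟩
    rw [add_zero, ← add_mul, Nat.add_sub_cancel' hp.one_le]
  · intro m hm hm1
    have hm0 := (Finset.mem_Ioo.mp hm).1
    have hlt : p ^ n < m * p ^ n := lt_mul_of_one_lt_left hq (by omega)
    rw [hterm, trinomialWeight, if_neg (by omega), mul_zero]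

lemma rowIdeal_ne_top (hp : p.Prime) : rowIdeal k p n ≠ ⊤ := fun h ↦
  frobeniusCarry_notMem_rowIdeal n hp (h ▸ Submodule.mem_top)

lemma isNilpotent_mk_X [CharP k p] (hp : p.Prime) (v : Fin 3 × Fin (n + 1)) :
    IsNilpotent (Ideal.Quotient.mk (rowIdeal k p n) (X v)) :=
  ⟨p * p ^ n, by
    rw [← map_pow]
    exact Ideal.Quotient.eq_zero_iff_mem.mpr (X_pow_mem_rowIdeal n hp v.1 v.2)⟩

end rowIdeal

end rowFunctional

/-! ### Liftings of the spectrum of a local algebra -/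

/-- A lifting of the spectrum of a local algebra `A` is a flat `R`-algebra `B` near the closed point,
with a surjection onto `A` whose kernel is extended from `R`. -/
lemma IsLiftable.exists_flat_algebra {R k A : Type u} [CommRing R] [Field k] [CommRing A]
    [Algebra k A] [IsLocalRing A] {φ : R →+* k} (hφ : Function.Surjective φ)
    (h : IsLiftable φ (Spec.map (CommRingCat.ofHom (algebraMap k A)))) :
    ∃ (B : Type u) (_ : CommRing B) (_ : Algebra R B) (ψ : B →+* A),
      Module.Flat R B ∧ Function.Surjective ψ ∧
      ψ.comp (algebraMap R B) = (algebraMap k A).comp φ ∧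
      RingHom.ker ψ ≤ (RingHom.ker φ).map (algebraMap R B) := by
  obtain ⟨Y, π, i, hπ, hi, hp⟩ := h
  let x : Spec (CommRingCat.of A) := IsLocalRing.closedPoint A
  obtain ⟨U, hU, hxU, -⟩ := exists_isAffineOpen_mem_and_subset (U := ⊤) (x := i x) (by trivial)
  -- An open set containing the closed point is everything, so `i` factors through `U`.
  have hrange : Set.range i ⊆ Set.range hU.fromSpec := by
    rw [hU.range_fromSpec]
    have hpre : i ⁻¹ᵁ U = ⊤ := (IsLocalRing.closedPoint_mem_iff (R := A) (i ⁻¹ᵁ U)).mp hxU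
    rintro _ ⟨y, rfl⟩
    exact hpre.ge (TopologicalSpace.Opens.mem_top y)
  let B := Γ(Y, U)
  let ψ : B ⟶ CommRingCat.of A := Spec.preimage (IsOpenImmersion.lift hU.fromSpec i hrange)
  let α : CommRingCat.of R ⟶ B := Spec.preimage (hU.fromSpec ≫ π)
  have hψ : Spec.map ψ ≫ hU.fromSpec = i := by
    rw [Spec.map_preimage, IsOpenImmersion.lift_fac]
  have hα : Spec.map α = hU.fromSpec ≫ π := Spec.map_preimage _
  have hcomp : α ≫ ψ = CommRingCat.ofHom φ ≫ CommRingCat.ofHom (algebraMap k A) := by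
    apply Spec.map_injective
    rw [Spec.map_comp, Spec.map_comp, hα, ← Category.assoc, hψ, hp.w]
  let : Algebra R B := α.hom.toAlgebra
  refine ⟨B, inferInstance, inferInstance, ψ.hom, ?_, ?_, ?_, ?_⟩
  · have : Flat (Spec.map α) := by rw [hα]; infer_instance
    exact Flat.SpecMap_iff.mp this
  · have : IsClosedImmersion (Spec.map ψ ≫ hU.fromSpec) := by rwa [hψ]
    have : IsClosedImmersion (Spec.map ψ) := IsClosedImmersion.of_comp _ hU.fromSpec
    have htop := (IsClosedImmersion.isAffine_surjective_of_isAffine (Spec.map ψ)).2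
    have hcomp : Function.Surjective ((Scheme.ΓSpecIso B).hom ≫ ψ) := by
      rw [← Scheme.ΓSpecIso_naturality]
      exact (ConcreteCategory.bijective_of_isIso (Scheme.ΓSpecIso _).hom).2.comp htop
    exact Function.Surjective.of_comp hcomp
  · exact congrArg CommRingCat.Hom.hom hcomp
  · -- The universal property of the base change makes `B ⟶ B / (ker φ) B` factor through `ψ`.
    let J : Ideal B := (RingHom.ker φ).map α.hom
    let β : k →+* B ⧸ J := RingHom.liftOfSurjective φ hφ
      ⟨(Ideal.Quotient.mk J).comp α.hom, fun r hr ↦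
        Ideal.Quotient.eq_zero_iff_mem.mpr (Ideal.mem_map_of_mem _ hr)⟩
    have hβ : β.comp φ = (Ideal.Quotient.mk J).comp α.hom :=
      RingHom.liftOfSurjective_comp _ _ _
    have hw : (Spec.map (CommRingCat.ofHom (Ideal.Quotient.mk J)) ≫ hU.fromSpec) ≫ π =
        Spec.map (CommRingCat.ofHom β) ≫ Spec.map (CommRingCat.ofHom φ) := by
      rw [Category.assoc, ← hα, ← Spec.map_comp, ← Spec.map_comp]
      congr 1
      ext1
      exact hβ.symm
    let γ : CommRingCat.of A ⟶ CommRingCat.of (B ⧸ J) := Spec.preimage (hp.lift _ _ hw)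
    have hγ : ψ ≫ γ = CommRingCat.ofHom (Ideal.Quotient.mk J) := by
      apply Spec.map_injective
      rw [← cancel_mono hU.fromSpec, Spec.map_comp, Category.assoc, hψ, Spec.map_preimage,
        hp.lift_fst]
    intro b hb
    have h1 : γ.hom (ψ.hom b) = Ideal.Quotient.mk J b :=
      RingHom.congr_fun (congrArg CommRingCat.Hom.hom hγ) b
    rw [RingHom.mem_ker.mp hb, map_zero] at h1
    exact Ideal.Quotient.eq_zero_iff_mem.mp h1.symm

/-! ### The algebra does not lift -/

/-- Over a local ring in which `p` lies outside an ideal containing `p * 𝔪` and `𝔪 ^ (n + 1)`, the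
Gorenstein algebra with parameter `n` has no lifting. -/
lemma not_isLiftable_rowIdeal {p n : ℕ} (hp : p.Prime) {k R : Type u} [Field k] [CharP k p]
    [CommRing R] [IsLocalRing R] {φ : R →+* k} (hφ : Function.Surjective φ) {I : Ideal R}
    (hpI : (p : R) ∉ I) (hann : ∀ a ∈ IsLocalRing.maximalIdeal R, (p : R) * a ∈ I)
    (hI : IsLocalRing.maximalIdeal R ^ (n + 1) ≤ I) :
    ¬ IsLiftable φ (Spec.map (CommRingCat.ofHom
      (algebraMap k (MvPolynomial (Fin 3 × Fin (n + 1)) k ⧸ rowIdeal k p n)))) := by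
  intro h
  have := isLocalRing_quotient_of_isNilpotent (rowIdeal_ne_top (k := k) n hp) (isNilpotent_mk_X n hp)
  obtain ⟨B, _, _, ψ, _, hsurj, hcomp, hker⟩ := h.exists_flat_algebra hφ
  have hkφ : RingHom.ker φ = IsLocalRing.maximalIdeal R :=
    IsLocalRing.eq_maximalIdeal (RingHom.ker_isMaximal_of_surjective φ hφ)
  rw [hkφ] at hker
  let J := I.map (algebraMap R B)
  let M := ((IsLocalRing.maximalIdeal R).map (algebraMap R B)).map (Ideal.Quotient.mk J)
  have hpm : (p : R) ∈ IsLocalRing.maximalIdeal R := by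
    rw [← hkφ, RingHom.mem_ker, map_natCast, CharP.cast_eq_zero]
  have hM : M ^ (n + 1) = ⊥ := by
    rw [← Ideal.map_pow, ← Ideal.map_pow, Ideal.map_eq_bot_iff_le_ker, Ideal.mk_ker]
    exact Ideal.map_mono hI
  have hmemM {b : B} (hb : ψ b = 0) : Ideal.Quotient.mk J b ∈ M :=
    Ideal.mem_map_of_mem _ (hker hb)
  have hpM : ((p : ℕ) : B ⧸ J) ∈ M := by
    have := Ideal.mem_map_of_mem (Ideal.Quotient.mk J) (Ideal.mem_map_of_mem (algebraMap R B) hpm)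
    simpa using this
  have hannM : ∀ a ∈ M, ((p : ℕ) : B ⧸ J) * a = 0 := by
    have hle : M ≤ LinearMap.ker (LinearMap.mulLeft (B ⧸ J) ((p : ℕ) : B ⧸ J)) := by
      refine Ideal.map_le_iff_le_comap.mpr (Ideal.map_le_iff_le_comap.mpr fun a ha ↦ ?_)
      have := Ideal.mem_map_of_mem (algebraMap R B) (hann a ha)
      have := Ideal.Quotient.eq_zero_iff_mem.mpr this
      simpa using! this
    exact fun a ha ↦ hle ha
  choose y hy using fun v : Fin 3 × Fin (n + 1) ↦
    hsurj (Ideal.Quotient.mk (rowIdeal k p n) (MvPolynomial.X v))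
  have hzero := natCast_mul_frobeniusCarry_eq_zero hp hM hpM hannM
    (fun j i ↦ Ideal.Quotient.mk J (y (j, i)))
    (fun j i ↦ by
      rw [← map_pow]
      refine hmemM ?_
      rw [map_pow, hy, ← map_pow]
      exact Ideal.Quotient.eq_zero_iff_mem.mpr (X_pow_mem_rowIdeal n hp j i))
    (by
      simp only [← map_prod, ← map_sum]
      refine hmemM ?_
      simp only [map_sum, map_prod, hy]
      simp only [← map_prod, ← map_sum]
      exact Ideal.Quotient.eq_zero_iff_mem.mpr (sum_prod_X_mem_rowIdeal n))
  simp only [← map_prod, ← map_pow, ← map_frobeniusCarry] at hzero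
  rw [← map_natCast (Ideal.Quotient.mk J), ← map_mul, Ideal.Quotient.eq_zero_iff_mem,
    ← map_natCast (algebraMap R B)] at hzero
  -- By flatness, the carry lies in `𝔪 B`: an element `a` with `p * a ∈ I` is not a unit.
  have hmem := mem_map_of_mul_mem_map_of_flat (J := IsLocalRing.maximalIdeal R)
    (fun a ha ↦ by
      by_contra hu
      rw [IsLocalRing.mem_maximalIdeal, mem_nonunits_iff, not_not] at hu
      exact hpI ((I.unit_mul_mem_iff_mem hu).mp (mul_comm (p : R) a ▸ ha))) hzero
  have hle : (IsLocalRing.maximalIdeal R).map (algebraMap R B) ≤ RingHom.ker ψ := by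
    refine Ideal.map_le_iff_le_comap.mpr fun a ha ↦ ?_
    rw [← hkφ] at ha
    rw [Ideal.mem_comap, RingHom.mem_ker, ← RingHom.comp_apply, hcomp, RingHom.comp_apply,
      RingHom.mem_ker.mp ha, map_zero]
  have hfin := RingHom.mem_ker.mp (hle hmem)
  simp only [map_frobeniusCarry, map_pow, map_prod, hy] at hfin
  simp only [← map_prod, ← map_pow, ← map_frobeniusCarry] at hfin
  exact frobeniusCarry_notMem_rowIdeal n hp (Ideal.Quotient.eq_zero_iff_mem.mp hfin)

lemma isZeroDimGorenstein_rowIdeal {p : ℕ} (hp : p.Prime) (n : ℕ) {k : Type u} [Field k]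
    [CharP k p] : IsZeroDimGorenstein (Spec.map (CommRingCat.ofHom
      (algebraMap k (MvPolynomial (Fin 3 × Fin (n + 1)) k ⧸ rowIdeal k p n)))) := by
  have := isLocalRing_quotient_of_isNilpotent (rowIdeal_ne_top (k := k) n hp) (isNilpotent_mk_X n hp)
  have := finite_quotient_of_isNilpotent (isNilpotent_mk_X (k := k) n hp)
  have := injective_quotient_functionalIdeal (rowFunctional k p n)
  exact isZeroDimGorenstein_spec

/-- Nakayama's lemma: a nonzero element is not a multiple of itself by the maximal ideal. -/
lemma notMem_span_singleton_mul_maximalIdeal {R : Type*} [CommRing R] [IsLocalRing R] {r : R}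
    (hr : r ≠ 0) : r ∉ Ideal.span {r} * IsLocalRing.maximalIdeal R := by
  intro h
  obtain ⟨a, ha, hra⟩ := Ideal.mem_span_singleton_mul.mp h
  have hu : IsUnit (1 - a) := by
    by_contra h1
    have h2 := add_mem ((IsLocalRing.mem_maximalIdeal _).mpr h1) ha
    rw [sub_add_cancel] at h2
    exact (Ideal.ne_top_iff_one _).mp (Ideal.IsPrime.ne_top inferInstance) h2
  exact hr ((hu.mul_left_eq_zero).mp (by rw [mul_sub, hra, mul_one, sub_self]))

/-- Krull's intersection theorem modulo an ideal `J`. -/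
lemma exists_notMem_sup_maximalIdeal_pow {R : Type*} [CommRing R] [IsLocalRing R]
    [IsNoetherianRing R] {J : Ideal R} {r : R} (hr : r ∉ J) :
    ∃ n, r ∉ J ⊔ IsLocalRing.maximalIdeal R ^ (n + 1) := by
  by_contra! h
  apply hr
  rw [← Ideal.Quotient.eq_zero_iff_mem]
  have hbot := Ideal.iInf_pow_smul_eq_bot_of_isLocalRing (M := R ⧸ J)
    (IsLocalRing.maximalIdeal R) (Ideal.IsPrime.ne_top inferInstance)
  rw [← Submodule.mem_bot R, ← hbot, Submodule.mem_iInf]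
  intro n
  obtain ⟨a, ha, b, hb, hab⟩ := Submodule.mem_sup.mp (h n)
  have hb' : b ∈ IsLocalRing.maximalIdeal R ^ n := Ideal.pow_le_pow_right n.le_succ hb
  have hbm := Submodule.smul_mem_smul (N := (⊤ : Submodule R (R ⧸ J))) hb'
    (Submodule.mem_top (x := (1 : R ⧸ J)))
  rw [← hab, map_add, Ideal.Quotient.eq_zero_iff_mem.mpr ha, zero_add]
  rwa [Algebra.smul_def, mul_one] at hbm

theorem mainTheorem1 (p : ℕ) (hp : 0 < p) (k : Type u) [Field k] [CharP k p] :
    (∀ (R : Type u) [CommRing R] [IsLocalRing R] [IsNoetherianRing R] (φ : R →+* k),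
      Function.Surjective φ → Ideal.span {(p : R)} ≠ ⊥ →
      ∃ (Z : Scheme.{u}) (f : Z ⟶ Spec (CommRingCat.of k)),
        IsZeroDimGorenstein f ∧ ¬ IsLiftable φ f) ∧
    (∀ e : ℕ, ∃ (Z : Scheme.{u}) (f : Z ⟶ Spec (CommRingCat.of k)),
      IsZeroDimGorenstein f ∧
      ∀ (R : Type u) [CommRing R] [IsLocalRing R] [IsNoetherianRing R] (φ : R →+* k),
        Function.Surjective φ → Ideal.span {(p : R)} ≠ ⊥ →
        IsLocalRing.maximalIdeal R ^ e ≤ Ideal.span {(p : R)} →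
        ¬ IsLiftable φ f) := by
  have hprime : p.Prime := (CharP.char_is_prime_or_zero k p).resolve_right hp.ne'
  refine ⟨fun R _ _ _ φ hφ hR ↦ ?_, fun e ↦ ⟨_, _, isZeroDimGorenstein_rowIdeal hprime e,
    fun R _ _ _ φ hφ hR he ↦ ?_⟩⟩
  · rw [Ne, Ideal.span_singleton_eq_bot] at hR
    obtain ⟨n, hn⟩ :=
      exists_notMem_sup_maximalIdeal_pow (notMem_span_singleton_mul_maximalIdeal hR)
    exact ⟨_, _, isZeroDimGorenstein_rowIdeal hprime n, not_isLiftable_rowIdeal hprime hφ hn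
      (fun a ha ↦ Ideal.mem_sup_left
        (Ideal.mul_mem_mul (Ideal.mem_span_singleton_self _) ha)) le_sup_right⟩
  · rw [Ne, Ideal.span_singleton_eq_bot] at hR
    exact not_isLiftable_rowIdeal hprime hφ (notMem_span_singleton_mul_maximalIdeal hR)
      (fun a ha ↦ Ideal.mul_mem_mul (Ideal.mem_span_singleton_self _) ha)
      (by rw [pow_succ]; exact Ideal.mul_mono_left he)
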